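/- A set $S\subset\mathbb{R}^m$ is a 2-distance set if exactly two values occur as distances between distinct points of $S$; its associated graph has vertex set $S$, two points being adjacent if and only if their distance is the larger of these two values. It is spherical if all its points lie on a sphere of some center and some positive radius in $\mathbb{R}^m$. A graph $G$ is representable (respectively, spherically representable) in $\mathbb{R}^m$ if it is isomorphic to the associated graph of some 2-distance set (respectively, some spherical 2-distance set) in $\mathbb{R}^m$. **Proposition.** Let $d$ be a positive integer, let $G$ be a graph on $d+2$ vertices that is spherically representable in $\mathbb{R}^d$, let $\lambda_1\ge\lambda_2\ge\dots\ge\lambda_{d+2}$ be the eigenvalues, with multiplicity, of its adjacency matrix $A_G$, and let $\mu=\#\{\,i : 2\le i\le d+2,\ \lambda_i=\lambda_2\,\}$ be the multiplicity of $\lambda_2$ in $A_G$ (excluding $\lambda_1$ if $\lambda_1=\lambda_2$). Then, for every integer $n$ with $1\le n\le d$, the following hold: 1. $G$ is spherically representable in $\mathbb{R}^n$ if and only if $\mu\ge d+1-n$; 2. $G$ is representable in $\mathbb{R}^n$ if and only if $\mu\ge d+1-n$. Moreover, $d+1-\mu$ is the smallest $m\ge 0$ such that $G$ is spherically representable in $\mathbb{R}^m$,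 and also the smallest $m\ge 0$ such that $G$ is representable in $\mathbb{R}^m$. -/

import Mathlib

/-- The set of distances between distinct points of `S`. -/
def distanceSet {d : ℕ} (S : Set (EuclideanSpace ℝ (Fin d))) : Set ℝ :=
  {t | ∃ p ∈ S, ∃ q ∈ S, p ≠ q ∧ dist p q = t}

/-- `S` is a 2-distance set: exactly two distances occur between distinct points of `S`. -/
def IsTwoDistanceSet {d : ℕ} (S : Set (EuclideanSpace ℝ (Fin d))) : Prop :=
  (distanceSet S).ncard = 2

/-- The associated graph of `S`: the vertices are the points of `S`, and two points are adjacent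
iff their distance is the largest distance occurring between distinct points of `S`. -/
def associatedGraph {d : ℕ} (S : Set (EuclideanSpace ℝ (Fin d))) : SimpleGraph S where
  Adj p q := IsGreatest (distanceSet S) (dist (p : EuclideanSpace ℝ (Fin d)) q)
  symm := ⟨fun p q h => by rwa [dist_comm]⟩
  loopless := ⟨fun p h => by
    obtain ⟨a, _, b, _, hab, h0⟩ := h.1
    rw [dist_self] at h0
    exact hab (dist_eq_zero.mp h0)⟩

/-- All points of `S` lie on a `(d - 1)`-dimensional sphere in `ℝ^d` (any center, any positive
radius). -/
def IsSphericalSet {d : ℕ} (S : Set (EuclideanSpace ℝ (Fin d))) : Prop :=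
  ∃ (c : EuclideanSpace ℝ (Fin d)) (r : ℝ), 0 < r ∧ S ⊆ Metric.sphere c r

/-- `G` is (isomorphic to) the associated graph of a 2-distance set in `ℝ^d`. -/
def IsRepresentable {V : Type*} (G : SimpleGraph V) (d : ℕ) : Prop :=
  ∃ S : Set (EuclideanSpace ℝ (Fin d)), IsTwoDistanceSet S ∧ Nonempty (G ≃g associatedGraph S)

/-- `G` is (isomorphic to) the associated graph of a spherical 2-distance set in `ℝ^d`. -/
def IsSphericallyRepresentable {V : Type*} (G : SimpleGraph V) (d : ℕ) : Prop :=
  ∃ S : Set (EuclideanSpace ℝ (Fin d)),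
    IsTwoDistanceSet S ∧ IsSphericalSet S ∧ Nonempty (G ≃g associatedGraph S)

theorem adjMatrix_real_isHermitian {V : Type*} (G : SimpleGraph V) [DecidableRel G.Adj] :
    (G.adjMatrix ℝ).IsHermitian := by
  rw [Matrix.IsHermitian, Matrix.conjTranspose_eq_transpose_of_trivial]
  exact G.transpose_adjMatrix

/-- The eigenvalues of the adjacency matrix of `G`, with multiplicity, in non-increasing order;
index `0` is `λ₁`, index `1` is `λ₂`, and so on. -/
noncomputable def adjEigenvalues {V : Type*} [Fintype V] [DecidableEq V] (G : SimpleGraph V)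
    [DecidableRel G.Adj] : Fin (Fintype.card V) → ℝ :=
  (adjMatrix_real_isHermitian G).eigenvalues₀

/-- The multiplicity of `λ₂` in the adjacency matrix of `G`, not counting `λ₁` when `λ₁ = λ₂`:
the number of indices `i ≥ 2` with `λᵢ = λ₂`. -/
noncomputable def secondEigenvalueMult {V : Type*} [Fintype V] [DecidableEq V]
    (G : SimpleGraph V) [DecidableRel G.Adj] (hV : 1 < Fintype.card V) : ℕ :=
  {i : Fin (Fintype.card V) | 1 ≤ i.val ∧ adjEigenvalues G i = adjEigenvalues G ⟨1, hV⟩}.ncard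

/-!
Let `A` be the adjacency matrix of `G`. If adjacent vertices are at distance `a` and nonadjacent
ones at distance `b < a`, then on vectors `v` with `∑ vᵢ = 0` one has
`2 ‖∑ vᵢ xᵢ‖² = b² v·v - (a² - b²) v·Av`. So with `τ = b² / (a² - b²)` the form of `A` is at most `τ`
on the hyperplane of zero-sum vectors, with equality exactly at the affine dependencies of the
points (`IsTwoDistanceEmbedding.form_le`, `IsTwoDistanceEmbedding.sum_smul_eq_zero_iff`). Since
`d + 2` points of `ℝᵈ` have a nonzero affine dependency, `τ` is the maximum of the Rayleigh quotient
on that hyperplane; hence any other representation with a nonzero dependency has the same `τ`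
and the same dependencies (`IsTwoDistanceEmbedding.dependency_mem`). With `k` the dimension of the
space `K` of dependencies, representability in `ℝⁿ` therefore forces `d + 1 - k ≤ n`. Conversely
the points span an affine space of dimension `d + 1 - k`, in which they still lie on a sphere
(`exists_isometric_spherical`).

It remains to see that `k` is the multiplicity of `λ₂` (`secondEigenvalueMult_eq_finrank`), and this
is where sphericity is used: pairing a dependency with the vectors from the center to the points
shows that `K` consists of `τ`-eigenvectors of `A`. By dimension counts, at most one eigenvalue
exceeds `τ` and at most `k + 1` are `≥ τ`. If `0 ≠ v ∈ K`, the entrywise absolute value `|v|` is not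
in `K`, and the form of `A` is at least `τ` on `K + ℝ|v|`, because `A` has nonnegative entries; so
exactly `k + 1` eigenvalues are `≥ τ`. Hence `λ₂ = τ`, with multiplicity `k` once `λ₁` is left out.
-/

open Matrix Module

/-! ### Counting eigenvalues of a symmetric matrix -/

section EigenvalueCounts

/-- A subspace `K` containing the kernel of a map to `F` has codimension at most `dim F`. -/
theorem finrank_le_of_ker_le {E F : Type*} [AddCommGroup E] [Module ℝ E] [FiniteDimensional ℝ E]
    [AddCommGroup F] [Module ℝ F] [FiniteDimensional ℝ F] (f : E →ₗ[ℝ] F) (K : Submodule ℝ E)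
    (h : LinearMap.ker f ≤ K) : finrank ℝ E ≤ finrank ℝ F + finrank ℝ K := by
  rw [← f.finrank_range_add_finrank_ker]
  exact add_le_add (Submodule.finrank_le _) (Submodule.finrank_mono h)

variable {V : Type*} [Fintype V] [DecidableEq V]

/-- Orthonormal eigencoordinates: they diagonalize both `x ⬝ᵥ x` and `x ⬝ᵥ A *ᵥ x`, with the
eigenvalues listed in non-increasing order. -/
theorem exists_eigencoordinates {A : Matrix V V ℝ} (hA : A.IsHermitian) :
    ∃ Φ : (V → ℝ) →ₗ[ℝ] (Fin (Fintype.card V) → ℝ),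
      (∀ x, x ⬝ᵥ x = ∑ i, Φ x i ^ 2) ∧
      (∀ x, x ⬝ᵥ A *ᵥ x = ∑ i, hA.eigenvalues₀ i * Φ x i ^ 2) := by
  have hS := isSymmetric_toEuclideanLin_iff.mpr hA
  let b := hS.eigenvectorBasis finrank_euclideanSpace
  refine ⟨(WithLp.linearEquiv 2 ℝ (Fin (Fintype.card V) → ℝ)).toLinearMap ∘ₗ
    b.repr.toLinearMap ∘ₗ (WithLp.linearEquiv 2 ℝ (V → ℝ)).symm.toLinearMap, ?_, ?_⟩
  · intro x
    have := b.repr.inner_map_map (WithLp.toLp 2 x) (WithLp.toLp 2 x)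
    simp only [EuclideanSpace.inner_eq_star_dotProduct, star_trivial] at this
    rw [← this]
    simp [dotProduct, pow_two]
  · intro x
    have := b.repr.inner_map_map (toEuclideanLin A (WithLp.toLp 2 x)) (WithLp.toLp 2 x)
    simp only [EuclideanSpace.inner_eq_star_dotProduct, star_trivial, toLpLin_toLp,
      toLin'_apply] at this
    rw [← this]
    simp only [dotProduct, LinearMap.comp_apply]
    refine Finset.sum_congr rfl fun i _ => ?_
    have h := hS.eigenvectorBasis_apply_self_apply finrank_euclideanSpace (WithLp.toLp 2 x) i
    simp only [b]
    have h' : (b.repr (toEuclideanLin A (WithLp.toLp 2 x))).ofLp i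
      = hA.eigenvalues₀ i * (b.repr (WithLp.toLp 2 x)).ofLp i := h
    have h2 : (b.repr (WithLp.toLp 2 (A *ᵥ x))).ofLp i
      = hA.eigenvalues₀ i * (b.repr (WithLp.toLp 2 x)).ofLp i := by
      rw [← h', toLpLin_toLp]; rfl
    simp [b] at h2 ⊢
    rw [h2]
    ring

section Counting

variable {A : Matrix V V ℝ} (hA : A.IsHermitian) (τ : ℝ)

/-- If the quadratic form of `A` is at least `τ` on `U`, then `A` has at least `dim U` eigenvalues
`≥ τ`. -/
theorem finrank_le_card_eigenvalues_ge (U : Submodule ℝ (V → ℝ))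
    (hU : ∀ x ∈ U, τ * (x ⬝ᵥ x) ≤ x ⬝ᵥ A *ᵥ x) :
    finrank ℝ U ≤ Fintype.card {i // τ ≤ hA.eigenvalues₀ i} := by
  obtain ⟨Φ, h1, h2⟩ := exists_eigencoordinates hA
  have key := LinearMap.finrank_le_finrank_of_injective
    (f := (LinearMap.funLeft ℝ ℝ (Subtype.val : {i // τ ≤ hA.eigenvalues₀ i} → _)) ∘ₗ Φ ∘ₗ
      U.subtype) ?_
  · simpa using key
  · rw [← LinearMap.ker_eq_bot, LinearMap.ker_eq_bot']
    intro x hx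
    have hz : ∀ i, τ ≤ hA.eigenvalues₀ i → Φ x i = 0 := fun i hi => congrFun hx ⟨i, hi⟩
    have hn : ∀ i ∈ Finset.univ, 0 ≤ (τ - hA.eigenvalues₀ i) * Φ x i ^ 2 := by
      intro i _
      by_cases hi : τ ≤ hA.eigenvalues₀ i
      · simp [hz i hi]
      · exact mul_nonneg (by linarith) (sq_nonneg _)
    have hs : ∑ i, (τ - hA.eigenvalues₀ i) * Φ x i ^ 2 = 0 := by
      refine le_antisymm ?_ (Finset.sum_nonneg hn)
      have := hU x x.2
      rw [h1, h2, Finset.mul_sum] at this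
      simp only [sub_mul, Finset.sum_sub_distrib]
      linarith
    have h0 : ∀ i, Φ x i = 0 := by
      intro i
      by_cases hi : τ ≤ hA.eigenvalues₀ i
      · exact hz i hi
      · have := (Finset.sum_eq_zero_iff_of_nonneg hn).1 hs i (Finset.mem_univ _)
        exact pow_eq_zero_iff two_ne_zero |>.1
          ((mul_eq_zero.1 this).resolve_left (by linarith))
    have := h1 x
    simp only [h0] at this
    exact Subtype.ext (dotProduct_self_eq_zero.1 (by simpa using this))

/-- If the quadratic form of `A` is at most `τ` on the hyperplane of vectors with zero sum, then
`A` has at most one eigenvalue `> τ`. -/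
theorem card_eigenvalues_gt_le_one
    (hU : ∀ x : V → ℝ, ∑ i, x i = 0 → x ⬝ᵥ A *ᵥ x ≤ τ * (x ⬝ᵥ x)) :
    Fintype.card {i // τ < hA.eigenvalues₀ i} ≤ 1 := by
  obtain ⟨Φ, h1, h2⟩ := exists_eigencoordinates hA
  have key := finrank_le_of_ker_le
    (((LinearMap.funLeft ℝ ℝ (Subtype.val : {i // ¬ τ < hA.eigenvalues₀ i} → _)) ∘ₗ Φ).prod
      (∑ i, LinearMap.proj (φ := fun _ : V => ℝ) i)) ⊥ ?_
  · have := Fintype.card_subtype_compl (fun i => τ < hA.eigenvalues₀ i)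
    have := Fintype.card_subtype_le (fun i => τ < hA.eigenvalues₀ i)
    simp only [finrank_prod, finrank_bot, finrank_fintype_fun_eq_card, finrank_self,
      Fintype.card_fin] at *
    omega
  · intro x hx
    replace hx := Prod.mk_eq_zero.1 (LinearMap.mem_ker.1 hx)
    have hz : ∀ i, ¬ τ < hA.eigenvalues₀ i → Φ x i = 0 := fun i hi => congrFun hx.1 ⟨i, hi⟩
    have hn : ∀ i ∈ Finset.univ, 0 ≤ (hA.eigenvalues₀ i - τ) * Φ x i ^ 2 := by
      intro i _
      by_cases hi : τ < hA.eigenvalues₀ i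
      · exact mul_nonneg (by linarith) (sq_nonneg _)
      · simp [hz i hi]
    have hs : ∑ i, (hA.eigenvalues₀ i - τ) * Φ x i ^ 2 = 0 := by
      refine le_antisymm ?_ (Finset.sum_nonneg hn)
      have := hU x (by simpa using hx.2)
      rw [h1, h2, Finset.mul_sum] at this
      simp only [sub_mul, Finset.sum_sub_distrib]
      linarith
    have h0 : ∀ i, Φ x i = 0 := by
      intro i
      by_cases hi : τ < hA.eigenvalues₀ i
      · have := (Finset.sum_eq_zero_iff_of_nonneg hn).1 hs i (Finset.mem_univ _)
        exact pow_eq_zero_iff two_ne_zero |>.1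
          ((mul_eq_zero.1 this).resolve_left (by linarith))
      · exact hz i hi
    have := h1 x
    simp only [h0] at this
    exact dotProduct_self_eq_zero.1 (by simpa using this)

/-- If every vector of zero sum on which the quadratic form of `A` is at least `τ` lies in `K`,
then `A` has at most `dim K + 1` eigenvalues `≥ τ`. -/
theorem card_eigenvalues_ge_le (K : Submodule ℝ (V → ℝ))
    (hK : ∀ x : V → ℝ, ∑ i, x i = 0 → τ * (x ⬝ᵥ x) ≤ x ⬝ᵥ A *ᵥ x → x ∈ K) :
    Fintype.card {i // τ ≤ hA.eigenvalues₀ i} ≤ finrank ℝ K + 1 := by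
  obtain ⟨Φ, h1, h2⟩ := exists_eigencoordinates hA
  have key := finrank_le_of_ker_le
    (((LinearMap.funLeft ℝ ℝ (Subtype.val : {i // ¬ τ ≤ hA.eigenvalues₀ i} → _)) ∘ₗ Φ).prod
      (∑ i, LinearMap.proj (φ := fun _ : V => ℝ) i)) K ?_
  · have := Fintype.card_subtype_compl (fun i => τ ≤ hA.eigenvalues₀ i)
    have := Fintype.card_subtype_le (fun i => τ ≤ hA.eigenvalues₀ i)
    simp only [finrank_prod, finrank_fintype_fun_eq_card, finrank_self, Fintype.card_fin] at *
    omega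
  · intro x hx
    replace hx := Prod.mk_eq_zero.1 (LinearMap.mem_ker.1 hx)
    have hz : ∀ i, ¬ τ ≤ hA.eigenvalues₀ i → Φ x i = 0 := fun i hi => congrFun hx.1 ⟨i, hi⟩
    refine hK x (by simpa using hx.2) ?_
    rw [h1, h2, Finset.mul_sum]
    refine Finset.sum_le_sum fun i _ => ?_
    by_cases hi : τ ≤ hA.eigenvalues₀ i
    · exact mul_le_mul_of_nonneg_right hi (sq_nonneg _)
    · simp [hz i hi]

end Counting

/-- For a non-increasing sequence with `k + 1 ≥ 2` terms `≥ τ` and at most one term `> τ`, the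
second term is `τ`, and `τ` occurs exactly `k` times from the second term on. -/
theorem ncard_eq_second_of_antitone {N k : ℕ} (l : Fin N → ℝ) (hl : Antitone l) (hN : 1 < N)
    (τ : ℝ) (hk : 1 ≤ k) (hge : Fintype.card {i // τ ≤ l i} = k + 1)
    (hgt : Fintype.card {i // τ < l i} ≤ 1) :
    {i : Fin N | 1 ≤ i.val ∧ l i = l ⟨1, hN⟩}.ncard = k := by
  have h0N : 0 < N := by omega
  have h01 : (⟨0, h0N⟩ : Fin N) ≠ ⟨1, hN⟩ := by simp [Fin.ext_iff]
  rw [Fintype.card_subtype] at hge hgt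
  have hle : l ⟨1, hN⟩ ≤ τ := by
    by_contra! h
    have : ({⟨0, h0N⟩, ⟨1, hN⟩} : Finset (Fin N)) ⊆ Finset.univ.filter (fun i => τ < l i) := by
      intro i hi
      simp only [Finset.mem_insert, Finset.mem_singleton] at hi
      simp only [Finset.mem_filter_univ]
      rcases hi with rfl | rfl
      · exact h.trans_le (hl (by simp))
      · exact h
    have := Finset.card_le_card this
    rw [Finset.card_pair h01] at this
    omega
  have hge1 : τ ≤ l ⟨1, hN⟩ := by
    by_contra! h
    have : Finset.univ.filter (fun i => τ ≤ l i) ⊆ {⟨0, h0N⟩} := by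
      intro i hi
      simp only [Finset.mem_filter_univ] at hi
      by_contra hi0
      have h1i : (⟨1, hN⟩ : Fin N) ≤ i := by
        simp only [Finset.mem_singleton, Fin.ext_iff] at hi0
        rw [Fin.le_def]; simp only; omega
      linarith [hl h1i]
    have := Finset.card_le_card this
    simp at this
    omega
  have h1 : l ⟨1, hN⟩ = τ := le_antisymm hle hge1
  have hset : {i : Fin N | 1 ≤ i.val ∧ l i = l ⟨1, hN⟩} =
      ((Finset.univ.filter (fun i => τ ≤ l i)).erase ⟨0, h0N⟩ : Finset (Fin N)) := by
    ext i
    simp only [Set.mem_ofPred_eq, Finset.coe_erase, Set.mem_sdiff, Finset.mem_coe,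
      Finset.mem_filter_univ, Set.mem_singleton_iff, Fin.ext_iff, h1]
    constructor
    · rintro ⟨hi, h⟩
      exact ⟨h.ge, by omega⟩
    · rintro ⟨h, hi⟩
      have h1i : (⟨1, hN⟩ : Fin N) ≤ i := by rw [Fin.le_def]; simp only; omega
      exact ⟨by omega, le_antisymm (h1 ▸ hl h1i) h⟩
  rw [hset, Set.ncard_coe_finset, Finset.card_erase_of_mem, hge]
  · rfl
  · simp only [Finset.mem_filter_univ]
    exact hge1.trans (hl (by simp))

end EigenvalueCounts

/-! ### Dependencies and zero-sum eigenvectors -/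

section Dependencies

variable {V : Type*} [Fintype V]

/-- The vectors of zero sum that are eigenvectors of the adjacency matrix for `τ`. -/
def zeroSumEigenspace (G : SimpleGraph V) [DecidableRel G.Adj] (τ : ℝ) : Submodule ℝ (V → ℝ) :=
  LinearMap.ker (∑ i, LinearMap.proj (φ := fun _ : V => ℝ) i) ⊓
    LinearMap.ker ((G.adjMatrix ℝ).mulVecLin - τ • LinearMap.id)

theorem mem_zeroSumEigenspace {G : SimpleGraph V} [DecidableRel G.Adj] {τ : ℝ} {v : V → ℝ} :
    v ∈ zeroSumEigenspace G τ ↔ ∑ i, v i = 0 ∧ G.adjMatrix ℝ *ᵥ v = τ • v := by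
  simp [zeroSumEigenspace, sub_eq_zero]

/-- Affine dependencies among the vertices have dimension at least `|V| - 1 - n`. -/
theorem card_le_of_dependencies_le {n : ℕ} (x : V → EuclideanSpace ℝ (Fin n)) (K : Submodule ℝ (V → ℝ))
    (hK : ∀ v : V → ℝ, ∑ i, v i = 0 → ∑ i, v i • x i = 0 → v ∈ K) :
    Fintype.card V ≤ n + 1 + finrank ℝ K := by
  have key := finrank_le_of_ker_le
    ((Fintype.linearCombination ℝ x).prod (∑ i, LinearMap.proj (φ := fun _ : V => ℝ) i)) K ?_
  · simpa using key
  · intro v hv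
    replace hv := Prod.mk_eq_zero.1 (LinearMap.mem_ker.1 hv)
    exact hK v (by simpa using hv.2) (by simpa [Fintype.linearCombination_apply] using hv.1)

end Dependencies

/-! ### Graphs realized by two distances -/

section TwoDistanceEmbeddings

variable {V : Type*} [DecidableEq V]

/-- `x` places the vertices of `G` in `ℝⁿ` with adjacent vertices at distance `a` and distinct
nonadjacent ones at the smaller positive distance `b`. -/
def IsTwoDistanceEmbedding (G : SimpleGraph V) [DecidableRel G.Adj] {n : ℕ}
    (x : V → EuclideanSpace ℝ (Fin n)) (a b : ℝ) : Prop :=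
  0 < b ∧ b < a ∧ ∀ u v, dist (x u) (x v) = if u = v then 0 else if G.Adj u v then a else b

/-- The image of `V` in a two-distance set isomorphic to `G` is a two-distance embedding, and both
distances occur. -/
theorem exists_isTwoDistanceEmbedding {G : SimpleGraph V} [DecidableRel G.Adj] {n : ℕ}
    {S : Set (EuclideanSpace ℝ (Fin n))} (hS : IsTwoDistanceSet S) (f : G ≃g associatedGraph S) :
    (∃ a b, IsTwoDistanceEmbedding G (fun v => (f v : EuclideanSpace ℝ (Fin n))) a b) ∧
      (∃ u v, G.Adj u v) ∧ ∃ u v, u ≠ v ∧ ¬ G.Adj u v := by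
  obtain ⟨b, a, hba, hD⟩ : ∃ b a : ℝ, b < a ∧ distanceSet S = {b, a} := by
    obtain ⟨p, q, hpq, h⟩ := Set.ncard_eq_two.1 hS
    rcases lt_or_gt_of_ne hpq with h' | h'
    · exact ⟨p, q, h', h⟩
    · exact ⟨q, p, h', by rw [h, Set.pair_comm]⟩
  have hgr : IsGreatest (distanceSet S) a := by
    rw [hD]
    exact ⟨by simp, by rintro y (rfl | rfl); exacts [hba.le, le_rfl]⟩
  have hadj : ∀ u v, G.Adj u v ↔ dist (f u : EuclideanSpace ℝ (Fin n)) (f v) = a := by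
    intro u v
    rw [← f.map_adj_iff]
    exact ⟨fun h => IsGreatest.unique h hgr, fun h => by
      change IsGreatest _ _
      rwa [h]⟩
  have hmem : ∀ t ∈ distanceSet S, ∃ u v, u ≠ v ∧
      dist (f u : EuclideanSpace ℝ (Fin n)) (f v) = t := by
    rintro t ⟨p, hp, q, hq, hpq, h⟩
    refine ⟨f.symm ⟨p, hp⟩, f.symm ⟨q, hq⟩, fun h' => hpq ?_, by simpa using h⟩
    simpa using h'
  obtain ⟨u, v, huv, hb⟩ := hmem b (by simp [hD])
  obtain ⟨u', v', -, ha⟩ := hmem a (by simp [hD])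
  have hne : ∀ u v, u ≠ v → (f u : EuclideanSpace ℝ (Fin n)) ≠ f v := fun u v h h' =>
    h (f.injective (Subtype.ext h'))
  refine ⟨⟨a, b, hb ▸ dist_pos.2 (hne u v huv), hba, fun u v => ?_⟩, ⟨u', v', (hadj u' v').2 ha⟩,
    u, v, huv, fun h => hba.ne (hb.symm.trans ((hadj u v).1 h))⟩
  split_ifs with h1 h2
  · simp [h1]
  · exact (hadj u v).1 h2
  · have : dist (f u : EuclideanSpace ℝ (Fin n)) (f v) ∈ distanceSet S :=
      ⟨_, (f u).2, _, (f v).2, hne u v h1, rfl⟩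
    rw [hD] at this
    rcases this with h | h
    · exact h
    · exact absurd ((hadj u v).2 h) h2

/-- If both distances occur, the range of a two-distance embedding is a two-distance set whose
associated graph is `G`. -/
theorem IsTwoDistanceEmbedding.range {G : SimpleGraph V} [DecidableRel G.Adj] {n : ℕ}
    {x : V → EuclideanSpace ℝ (Fin n)} {a b : ℝ} (hx : IsTwoDistanceEmbedding G x a b)
    (hadj : ∃ u v, G.Adj u v) (hnadj : ∃ u v, u ≠ v ∧ ¬ G.Adj u v) :
    IsTwoDistanceSet (Set.range x) ∧ Nonempty (G ≃g associatedGraph (Set.range x)) := by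
  obtain ⟨hb, hba, hd⟩ := hx
  have hinj : Function.Injective x := by
    intro u v h
    by_contra huv
    have := hd u v
    rw [h, dist_self, if_neg huv] at this
    split_ifs at this <;> linarith
  have hD : distanceSet (Set.range x) = {b, a} := by
    ext t
    constructor
    · rintro ⟨_, ⟨u, rfl⟩, _, ⟨v, rfl⟩, huv, rfl⟩
      rw [hd, if_neg (fun h => huv (congrArg x h))]
      split_ifs <;> simp
    · rintro (rfl | rfl)
      · obtain ⟨u, v, huv, h⟩ := hnadj
        exact ⟨x u, ⟨u, rfl⟩, x v, ⟨v, rfl⟩, hinj.ne huv, by rw [hd, if_neg huv, if_neg h]⟩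
      · obtain ⟨u, v, h⟩ := hadj
        exact ⟨x u, ⟨u, rfl⟩, x v, ⟨v, rfl⟩, hinj.ne h.ne, by rw [hd, if_neg h.ne, if_pos h]⟩
  have hgr : IsGreatest (distanceSet (Set.range x)) a := by
    rw [hD]
    exact ⟨by simp, by rintro y (rfl | rfl); exacts [hba.le, le_rfl]⟩
  refine ⟨by rw [IsTwoDistanceSet, hD, Set.ncard_pair hba.ne],
    ⟨⟨Equiv.ofInjective x hinj, fun {u v} => ?_⟩⟩⟩
  change IsGreatest _ (dist (x u) (x v)) ↔ _
  constructor
  · intro h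
    have h := h.unique hgr
    rw [hd] at h
    split_ifs at h with h1 h2
    · linarith
    · exact h2
    · linarith
  · intro h
    rw [hd, if_neg h.ne, if_pos h]
    exact hgr

/-! ### The quadratic form of a two-distance embedding -/

section Form

variable {G : SimpleGraph V} [DecidableRel G.Adj] {n : ℕ}
  {x : V → EuclideanSpace ℝ (Fin n)} {a b : ℝ}

theorem IsTwoDistanceEmbedding.dist_sq (hx : IsTwoDistanceEmbedding G x a b) (u v : V) :
    dist (x u) (x v) ^ 2 = b ^ 2 - b ^ 2 * (1 : Matrix V V ℝ) u v
      + (a ^ 2 - b ^ 2) * G.adjMatrix ℝ u v := by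
  rw [hx.2.2, SimpleGraph.adjMatrix_apply, Matrix.one_apply]
  by_cases h : u = v
  · subst h; simp
  · by_cases h' : G.Adj u v <;> simp [h, h']

theorem IsTwoDistanceEmbedding.sq_sub_sq_pos (hx : IsTwoDistanceEmbedding G x a b) :
    0 < a ^ 2 - b ^ 2 := by
  nlinarith [hx.1, hx.2.1]

variable [Fintype V]

theorem IsTwoDistanceEmbedding.sum_mul_dist_sq (hx : IsTwoDistanceEmbedding G x a b)
    {v : V → ℝ} (hv : ∑ i, v i = 0) (j : V) :
    ∑ i, v i * dist (x j) (x i) ^ 2 =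
      (a ^ 2 - b ^ 2) * (G.adjMatrix ℝ *ᵥ v) j - b ^ 2 * v j := by
  have h1 : ∑ i, (1 : Matrix V V ℝ) j i * v i = v j := by
    simpa [mulVec, dotProduct] using congrFun (one_mulVec v) j
  calc ∑ i, v i * dist (x j) (x i) ^ 2
      = b ^ 2 * ∑ i, v i - b ^ 2 * ∑ i, (1 : Matrix V V ℝ) j i * v i
        + (a ^ 2 - b ^ 2) * ∑ i, G.adjMatrix ℝ j i * v i := by
        simp only [Finset.mul_sum, ← Finset.sum_sub_distrib, ← Finset.sum_add_distrib, hx.dist_sq]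
        exact Finset.sum_congr rfl fun i _ => by ring
    _ = _ := by
        rw [hv, h1]
        simp only [mulVec, dotProduct]
        ring

/-- On vectors of zero sum, the squared norm of `∑ vᵢ xᵢ` is the form
`(b² v·v - (a² - b²) v·Av) / 2`. -/
theorem IsTwoDistanceEmbedding.two_mul_norm_sq (hx : IsTwoDistanceEmbedding G x a b)
    {v : V → ℝ} (hv : ∑ i, v i = 0) :
    2 * ‖∑ i, v i • x i‖ ^ 2 =
      b ^ 2 * (v ⬝ᵥ v) - (a ^ 2 - b ^ 2) * (v ⬝ᵥ G.adjMatrix ℝ *ᵥ v) := by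
  rw [← real_inner_self_eq_norm_sq, inner_sum_smul_sum_smul_of_sum_eq_zero x hv x hv]
  have : ∀ i, ∑ j, v i * v j * (‖x i - x j‖ * ‖x i - x j‖) =
      v i * ((a ^ 2 - b ^ 2) * (G.adjMatrix ℝ *ᵥ v) i - b ^ 2 * v i) := by
    intro i
    rw [← hx.sum_mul_dist_sq hv, Finset.mul_sum]
    exact Finset.sum_congr rfl fun j _ => by rw [dist_eq_norm]; ring
  simp only [this, dotProduct, Finset.mul_sum, mul_sub, Finset.sum_sub_distrib]
  simp only [mul_left_comm]
  ring

theorem IsTwoDistanceEmbedding.form_le (hx : IsTwoDistanceEmbedding G x a b) (v : V → ℝ)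
    (hv : ∑ i, v i = 0) :
    v ⬝ᵥ G.adjMatrix ℝ *ᵥ v ≤ b ^ 2 / (a ^ 2 - b ^ 2) * (v ⬝ᵥ v) := by
  have h := hx.two_mul_norm_sq hv
  have := hx.sq_sub_sq_pos
  rw [div_mul_eq_mul_div, le_div_iff₀ this]
  nlinarith [sq_nonneg ‖∑ i, v i • x i‖]

theorem IsTwoDistanceEmbedding.sum_smul_eq_zero_iff (hx : IsTwoDistanceEmbedding G x a b)
    {v : V → ℝ} (hv : ∑ i, v i = 0) :
    ∑ i, v i • x i = 0 ↔ v ⬝ᵥ G.adjMatrix ℝ *ᵥ v = b ^ 2 / (a ^ 2 - b ^ 2) * (v ⬝ᵥ v) := by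
  have h := hx.two_mul_norm_sq hv
  have := hx.sq_sub_sq_pos
  rw [div_mul_eq_mul_div, eq_div_iff this.ne', ← norm_eq_zero, ← sq_eq_zero_iff]
  constructor <;> intro h' <;> linarith

/-- For points on a sphere, an affine dependency is an eigenvector: pair `∑ vᵢ (xᵢ - c) = 0` with
`xⱼ - c` and express the inner products by the distances. -/
theorem IsTwoDistanceEmbedding.mem_zeroSumEigenspace_of_sum_smul_eq_zero
    (hx : IsTwoDistanceEmbedding G x a b) {c : EuclideanSpace ℝ (Fin n)} {r : ℝ}
    (hc : ∀ i, dist (x i) c = r) {v : V → ℝ} (hv : ∑ i, v i = 0) (h0 : ∑ i, v i • x i = 0) :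
    v ∈ zeroSumEigenspace G (b ^ 2 / (a ^ 2 - b ^ 2)) := by
  have hpos := hx.sq_sub_sq_pos
  refine mem_zeroSumEigenspace.2 ⟨hv, funext fun j => ?_⟩
  have h1 : ∑ i, v i • (x i - c) = 0 := by
    simp only [smul_sub, Finset.sum_sub_distrib, h0, ← Finset.sum_smul, hv, zero_smul, sub_zero]
  have h2 : ∑ i, v i * inner ℝ (x j - c) (x i - c) = 0 := by
    rw [← inner_zero_right (x j - c), ← h1, inner_sum]
    simp only [real_inner_smul_right]
  have h3 : ∀ i, inner ℝ (x j - c) (x i - c) = r ^ 2 - dist (x j) (x i) ^ 2 / 2 := by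
    intro i
    rw [real_inner_eq_norm_mul_self_add_norm_mul_self_sub_norm_sub_mul_self_div_two,
      ← dist_eq_norm, ← dist_eq_norm, hc, hc, sub_sub_sub_cancel_right, ← dist_eq_norm]
    ring
  have h4 : ∑ i, v i * inner ℝ (x j - c) (x i - c) =
      r ^ 2 * ∑ i, v i - (∑ i, v i * dist (x j) (x i) ^ 2) / 2 := by
    rw [Finset.mul_sum, Finset.sum_div, ← Finset.sum_sub_distrib]
    exact Finset.sum_congr rfl fun i _ => by rw [h3]; ring
  rw [h4, hv, hx.sum_mul_dist_sq hv] at h2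
  rw [Pi.smul_apply, smul_eq_mul, div_mul_eq_mul_div, eq_div_iff hpos.ne']
  linarith

end Form

end TwoDistanceEmbeddings

/-! ### The second eigenvalue -/

section SecondEigenvalue

variable {V : Type*} [Fintype V]

theorem finrank_sup_span_singleton {E : Type*} [AddCommGroup E] [Module ℝ E]
    [FiniteDimensional ℝ E] {K : Submodule ℝ E} {w : E} (hw : w ∉ K) :
    finrank ℝ ↥(K ⊔ Submodule.span ℝ {w}) = finrank ℝ K + 1 := by
  have hw0 : w ≠ 0 := fun h => hw (h ▸ K.zero_mem)
  have h := Submodule.finrank_sup_add_finrank_inf_eq K (Submodule.span ℝ {w})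
  rwa [((Submodule.disjoint_span_singleton' hw0).2 hw).eq_bot, finrank_bot, add_zero,
    finrank_span_singleton hw0] at h

theorem dotProduct_mulVec_le_abs (G : SimpleGraph V) [DecidableRel G.Adj] (v : V → ℝ) :
    v ⬝ᵥ G.adjMatrix ℝ *ᵥ v ≤ |v| ⬝ᵥ G.adjMatrix ℝ *ᵥ |v| := by
  simp only [dotProduct, mulVec, Finset.mul_sum, Pi.abs_apply, SimpleGraph.adjMatrix_apply]
  refine Finset.sum_le_sum fun i _ => Finset.sum_le_sum fun j _ => ?_
  split_ifs
  · rw [one_mul, one_mul, ← abs_mul]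
    exact le_abs_self _
  · simp

variable [DecidableEq V]

/-- If `A ≤ τ` on the vectors of zero sum, with equality only at zero-sum `τ`-eigenvectors, and
there is such an eigenvector `v ≠ 0`, then `λ₂ = τ` with multiplicity `dim K`, where `K` is the
space of zero-sum `τ`-eigenvectors. -/
theorem secondEigenvalueMult_eq_finrank {G : SimpleGraph V} [DecidableRel G.Adj]
    (hV : 1 < Fintype.card V) {τ : ℝ}
    (hle : ∀ v : V → ℝ, ∑ i, v i = 0 → v ⬝ᵥ G.adjMatrix ℝ *ᵥ v ≤ τ * (v ⬝ᵥ v))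
    (heq : ∀ v : V → ℝ, ∑ i, v i = 0 → v ⬝ᵥ G.adjMatrix ℝ *ᵥ v = τ * (v ⬝ᵥ v) →
      v ∈ zeroSumEigenspace G τ)
    (hK : 1 ≤ finrank ℝ (zeroSumEigenspace G τ)) :
    secondEigenvalueMult G hV = finrank ℝ (zeroSumEigenspace G τ) := by
  have hA := adjMatrix_real_isHermitian G
  obtain ⟨⟨v, hv⟩, hv0⟩ := Module.finrank_pos_iff_exists_ne_zero.1 hK
  have hv0 : v ≠ 0 := fun h => hv0 (Subtype.ext h)
  have hv' := mem_zeroSumEigenspace.1 hv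
  have habs : |v| ∉ zeroSumEigenspace G τ := by
    intro h
    have h1 := (mem_zeroSumEigenspace.1 h).1
    simp only [Pi.abs_apply] at h1
    rw [Finset.sum_eq_zero_iff_of_nonneg (fun i _ => abs_nonneg (v i))] at h1
    exact hv0 (funext fun i => abs_eq_zero.1 (h1 i (Finset.mem_univ i)))
  have hform : τ * (|v| ⬝ᵥ |v|) ≤ |v| ⬝ᵥ G.adjMatrix ℝ *ᵥ |v| := by
    refine le_trans (le_of_eq ?_) (dotProduct_mulVec_le_abs G v)
    rw [hv'.2, dotProduct_smul, smul_eq_mul]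
    simp [dotProduct]
  refine ncard_eq_second_of_antitone _ hA.eigenvalues₀_antitone hV τ hK (le_antisymm ?_ ?_)
    (card_eigenvalues_gt_le_one hA τ hle)
  · exact card_eigenvalues_ge_le hA τ _ fun x hx h => heq x hx (le_antisymm (hle x hx) h)
  · -- The form is still `≥ τ` on the sum of `K` and the line of the nonnegative vector `|v|`.
    rw [← finrank_sup_span_singleton habs]
    refine finrank_le_card_eigenvalues_ge hA τ _ fun x hx => ?_
    obtain ⟨u, hu, y, hy, rfl⟩ := Submodule.mem_sup.1 hx
    obtain ⟨s, rfl⟩ := Submodule.mem_span_singleton.1 hy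
    have hu' := (mem_zeroSumEigenspace.1 hu).2
    have hsymm : u ⬝ᵥ G.adjMatrix ℝ *ᵥ |v| = τ * (u ⬝ᵥ |v|) := by
      rw [dotProduct_mulVec, ← mulVec_transpose, G.transpose_adjMatrix, hu', smul_dotProduct,
        smul_eq_mul]
    simp only [mulVec_add, mulVec_smul, add_dotProduct, dotProduct_add, smul_dotProduct,
      dotProduct_smul, smul_eq_mul, hu', hsymm, dotProduct_comm |v| u]
    nlinarith [mul_le_mul_of_nonneg_left hform (mul_self_nonneg s)]

/-! ### Lowering the dimension of a spherical configuration -/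

theorem exists_linearIsometry_euclideanSpace {E : Type*} [NormedAddCommGroup E]
    [InnerProductSpace ℝ E] [FiniteDimensional ℝ E] {n : ℕ} (h : finrank ℝ E ≤ n) :
    Nonempty (E →ₗᵢ[ℝ] EuclideanSpace ℝ (Fin n)) := by
  let e := stdOrthonormalBasis ℝ E
  refine ⟨LinearMap.isometryOfOrthonormal (v := e.toBasis) (e.toBasis.constr ℝ
    fun i => EuclideanSpace.basisFun (Fin n) ℝ (Fin.castLE h i)) (by simp) ?_⟩
  have : (e.toBasis.constr ℝ fun i => EuclideanSpace.basisFun (Fin n) ℝ (Fin.castLE h i)) ∘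
      e.toBasis = (EuclideanSpace.basisFun (Fin n) ℝ) ∘ Fin.castLE h := by
    ext1 i
    simp
  rw [this]
  exact (EuclideanSpace.basisFun (Fin n) ℝ).orthonormal.comp _ (Fin.castLE_injective h)

/-- Points on a sphere with a `k`-dimensional space of affine dependencies embed isometrically into
a sphere of `ℝⁿ` as soon as `|V| ≤ n + 1 + k`; the new center is the projection of the old one. -/
theorem exists_isometric_spherical {d n : ℕ} (x : V → EuclideanSpace ℝ (Fin d))
    (K : Submodule ℝ (V → ℝ)) (hK : ∀ v ∈ K, ∑ i, v i = 0 ∧ ∑ i, v i • x i = 0)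
    (hcard : Fintype.card V ≤ n + 1 + finrank ℝ K) {c : EuclideanSpace ℝ (Fin d)} {r : ℝ}
    (hc : ∀ i, dist (x i) c = r) (o : V) :
    ∃ (y : V → EuclideanSpace ℝ (Fin n)) (c' : EuclideanSpace ℝ (Fin n)) (r' : ℝ),
      (∀ i j, dist (y i) (y j) = dist (x i) (x j)) ∧ ∀ i, dist (y i) c' = r' := by
  let T := Fintype.linearCombination ℝ (fun i => x i - x o)
  have hT : ∀ i, T (Pi.single i 1) = x i - x o := fun i => by simp [T]
  have hoK : Pi.single o (1 : ℝ) ∉ K := fun h => by simpa using (hK _ h).1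
  have hker : K ⊔ Submodule.span ℝ {Pi.single o (1 : ℝ)} ≤ LinearMap.ker T := by
    refine sup_le (fun v hv => ?_) ?_
    · obtain ⟨h1, h2⟩ := hK v hv
      simp [T, Fintype.linearCombination_apply, smul_sub, h2, ← Finset.sum_smul, h1]
    · rw [Submodule.span_singleton_le_iff_mem, LinearMap.mem_ker, hT, sub_self]
  have hrank : finrank ℝ (LinearMap.range T) ≤ n := by
    have h1 := Submodule.finrank_mono hker
    rw [finrank_sup_span_singleton hoK] at h1
    have h2 := T.finrank_range_add_finrank_ker
    rw [finrank_fintype_fun_eq_card] at h2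
    omega
  obtain ⟨L⟩ := exists_linearIsometry_euclideanSpace hrank
  let P := (LinearMap.range T).orthogonalProjectionOnto
  let z : V → LinearMap.range T := fun i => ⟨x i - x o, _, hT i⟩
  have hz : ∀ i, dist (z i) (P (c - x o)) ^ 2 =
      r ^ 2 - ‖(LinearMap.range T)ᗮ.orthogonalProjectionOnto (x o - c)‖ ^ 2 := by
    intro i
    have h1 : z i - P (c - x o) = P (x i - c) := by
      rw [← sub_sub_sub_cancel_right (x i) c (x o), map_sub P (x i - x o)]
      exact congrArg (· - _)
        (Submodule.orthogonalProjectionOnto_mem_subspace_eq_self (z i)).symm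
    -- The component orthogonal to the direction space does not depend on `i`.
    have h2 : (LinearMap.range T)ᗮ.orthogonalProjectionOnto (x i - c) =
        (LinearMap.range T)ᗮ.orthogonalProjectionOnto (x o - c) := by
      rw [← sub_eq_zero, ← map_sub, sub_sub_sub_cancel_right]
      exact Submodule.orthogonalProjectionOnto_orthogonal_apply_eq_zero (z i).2
    have h3 := Submodule.norm_sq_eq_add_norm_sq_projection (x i - c) (LinearMap.range T)
    rw [h2, ← dist_eq_norm (x i), hc] at h3
    rw [dist_eq_norm, h1]
    exact (sub_eq_of_eq_add h3).symm
  refine ⟨fun i => L (z i), L (P (c - x o)), dist (z o) (P (c - x o)), fun i j => ?_, fun i => ?_⟩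
  · rw [L.dist_map, Subtype.dist_eq, dist_sub_right]
  · rw [L.dist_map, ← sq_eq_sq₀ dist_nonneg dist_nonneg]
    linarith [hz i, hz o]

/-! ### Representability in terms of the second eigenvalue -/

/-- Dependencies of a two-distance embedding in any dimension are dependencies of one given
spherical embedding that has a nonzero dependency: both forms `b² v·v - (a² - b²) v·Av` are
nonnegative on zero-sum vectors and vanish somewhere, so they are proportional. -/
theorem IsTwoDistanceEmbedding.dependency_mem {G : SimpleGraph V} [DecidableRel G.Adj] {d n : ℕ}
    {x : V → EuclideanSpace ℝ (Fin d)} {a b : ℝ} (hx : IsTwoDistanceEmbedding G x a b)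
    {c : EuclideanSpace ℝ (Fin d)} {r : ℝ} (hc : ∀ i, dist (x i) c = r)
    (hK : 1 ≤ finrank ℝ (zeroSumEigenspace G (b ^ 2 / (a ^ 2 - b ^ 2))))
    {y : V → EuclideanSpace ℝ (Fin n)} {a' b' : ℝ} (hy : IsTwoDistanceEmbedding G y a' b')
    {v : V → ℝ} (hv : ∑ i, v i = 0) (h0 : ∑ i, v i • y i = 0) :
    v ∈ zeroSumEigenspace G (b ^ 2 / (a ^ 2 - b ^ 2)) := by
  by_cases hv0 : v = 0
  · exact hv0 ▸ Submodule.zero_mem _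
  obtain ⟨⟨w, hw⟩, hw0⟩ := Module.finrank_pos_iff_exists_ne_zero.1 hK
  obtain ⟨hw1, hw2⟩ := mem_zeroSumEigenspace.1 hw
  have hpos : ∀ u : V → ℝ, u ≠ 0 → 0 < u ⬝ᵥ u := fun u hu =>
    lt_of_le_of_ne (Finset.sum_nonneg fun i _ => mul_self_nonneg _)
      (Ne.symm (mt dotProduct_self_eq_zero.1 hu))
  have e1 := (hy.sum_smul_eq_zero_iff hv).1 h0
  have e2 := hx.form_le v hv
  have e3 := hy.form_le w hw1
  rw [hw2, dotProduct_smul, smul_eq_mul] at e3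
  rw [e1] at e2
  have hτ := le_antisymm (le_of_mul_le_mul_right e2 (hpos v hv0))
    (le_of_mul_le_mul_right e3 (hpos w fun h => hw0 (Subtype.ext h)))
  exact hx.mem_zeroSumEigenspace_of_sum_smul_eq_zero hc hv
    ((hx.sum_smul_eq_zero_iff hv).2 (hτ ▸ e1))

theorem representable_iff_le_add_secondEigenvalueMult {G : SimpleGraph V} [DecidableRel G.Adj]
    {d : ℕ} (hcard : Fintype.card V = d + 2) (hV : 1 < Fintype.card V)
    (hG : IsSphericallyRepresentable G d) (n : ℕ) :
    (IsSphericallyRepresentable G n ↔ d + 1 ≤ n + secondEigenvalueMult G hV) ∧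
      (IsRepresentable G n ↔ d + 1 ≤ n + secondEigenvalueMult G hV) := by
  obtain ⟨S, hS, ⟨c, r, hr, hSc⟩, ⟨f⟩⟩ := hG
  obtain ⟨⟨a, b, hx⟩, hadj, hnadj⟩ := exists_isTwoDistanceEmbedding hS f
  set x : V → EuclideanSpace ℝ (Fin d) := fun v => f v
  have hc : ∀ i, dist (x i) c = r := fun i => hSc (f i).2
  set K := zeroSumEigenspace G (b ^ 2 / (a ^ 2 - b ^ 2)) with hKdef
  have hK : 1 ≤ finrank ℝ K := by
    have := card_le_of_dependencies_le x K fun v hv h0 =>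
      hx.mem_zeroSumEigenspace_of_sum_smul_eq_zero hc hv h0
    omega
  have hmult : secondEigenvalueMult G hV = finrank ℝ K :=
    secondEigenvalueMult_eq_finrank hV hx.form_le (fun v hv h =>
      hx.mem_zeroSumEigenspace_of_sum_smul_eq_zero hc hv ((hx.sum_smul_eq_zero_iff hv).2 h)) hK
  rw [hmult]
  have hnec : IsRepresentable G n → d + 1 ≤ n + finrank ℝ K := by
    rintro ⟨S', hS', ⟨f'⟩⟩
    obtain ⟨⟨a', b', hy⟩, -, -⟩ := exists_isTwoDistanceEmbedding hS' f'
    have := card_le_of_dependencies_le _ K fun v hv h0 => hx.dependency_mem hc hK hy hv h0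
    omega
  have hsuff : d + 1 ≤ n + finrank ℝ K → IsSphericallyRepresentable G n := by
    intro hn
    obtain ⟨u, w, huw⟩ := hadj
    have hdep : ∀ v ∈ K, ∑ i, v i = 0 ∧ ∑ i, v i • x i = 0 := by
      intro v hv
      obtain ⟨h1, h2⟩ := mem_zeroSumEigenspace.1 hv
      refine ⟨h1, (hx.sum_smul_eq_zero_iff h1).2 ?_⟩
      rw [h2, dotProduct_smul, smul_eq_mul]
    obtain ⟨y, c', r', hy, hc'⟩ := exists_isometric_spherical (n := n) x K hdep (by omega) hc u
    have hy' : IsTwoDistanceEmbedding G y a b :=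
      ⟨hx.1, hx.2.1, fun i j => (hy i j).trans (hx.2.2 i j)⟩
    obtain ⟨h1, h2⟩ := hy'.range ⟨u, w, huw⟩ hnadj
    refine ⟨Set.range y, h1, ⟨c', r', ?_, ?_⟩, h2⟩
    · -- Two points at the positive distance `a` cannot both be the center.
      have h3 := hy'.2.2 u w
      rw [if_neg huw.ne, if_pos huw] at h3
      have h4 := dist_triangle_right (y u) (y w) c'
      rw [hc', hc', h3] at h4
      linarith [hx.1, hx.2.1]
    · rintro _ ⟨i, rfl⟩
      exact hc' i
  have himp : IsSphericallyRepresentable G n → IsRepresentable G n :=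
    fun ⟨S', h1, _, h3⟩ => ⟨S', h1, h3⟩
  exact ⟨⟨fun h => hnec (himp h), hsuff⟩, ⟨hnec, fun h => himp (hsuff h)⟩⟩

end SecondEigenvalue

theorem proposition1p2 {V : Type*} [Fintype V] [DecidableEq V] (G : SimpleGraph V)
    [DecidableRel G.Adj] (d : ℕ) (hd : 1 ≤ d) (hcard : Fintype.card V = d + 2)
    (hG : IsSphericallyRepresentable G d) :
    (∀ n : ℕ, 1 ≤ n → n ≤ d →
      (IsSphericallyRepresentable G n ↔ d + 1 - n ≤ secondEigenvalueMult G (by omega)) ∧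
      (IsRepresentable G n ↔ d + 1 - n ≤ secondEigenvalueMult G (by omega))) ∧
    IsLeast {m : ℕ | IsSphericallyRepresentable G m} (d + 1 - secondEigenvalueMult G (by omega)) ∧
    IsLeast {m : ℕ | IsRepresentable G m} (d + 1 - secondEigenvalueMult G (by omega)) := by
  have key := representable_iff_le_add_secondEigenvalueMult hcard (by omega) hG
  refine ⟨fun n _ _ => ?_, ⟨(key _).1.2 (by omega), fun m hm => ?_⟩,
    ⟨(key _).2.2 (by omega), fun m hm => ?_⟩⟩
  · rw [(key n).1, (key n).2, tsub_le_iff_left, and_self]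
  · have := (key m).1.1 hm
    omega
  · have := (key m).2.1 hm
    omega
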